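/- Let $\theta\in[0,1)$. There is a constant $C>0$, depending only on $\theta$, such that the following holds. Let $A\in\mathbb R^{m\times n}$ have full row rank $m$. Let $(x,y,s)\in\mathbb R^{n}\times\mathbb R^m\times\mathbb R^n$ lie in the neighborhood $\mathcal N_2(\theta)$, i.e. $x>0$, $s>0$ and $\|x\circ s-\mu\mathbf 1\|_2\le\theta\mu$, where $\mu=x^Ts/n$. Put $X=\mathrm{diag}(x)$, $S=\mathrm{diag}(s)$, $D=X^{1/2}S^{-1/2}$ and let $AD=U\Sigma V^T$ be a thin SVD ($U\in\mathbb R^{m\times m}$, $V\in\mathbb R^{n\times m}$). Let $\sigma\in[0,1]$, $p=-\sigma\mu AS^{-1}\mathbf 1+Ax$, $\zeta\in(0,1)$, $\eta\in(0,1)$ and $\delta>0$. Let $W\in\mathbb R^{n\times w}$ be a random sparse sketching matrix: almost surely every row of $W$ has at most $k$ nonzero entries and Euclidean norm $1$ (for instance exactly $k$ nonzero entries, each equal to $\pm1/\sqrt k$), and, with probability at least $1-\eta$, $$\|V^TWW^TV-I_m\|_2\le \zeta/2 .$$ For $t\ge0$ let $\Delta\tilde y=Q^{-1/2}\tilde z^{t}$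 be the output of $t$ iterations of preconditioned conjugate gradient with preconditioner $Q=ADWW^TDA^T$, where $\tilde z^{t}$ is the $t$-th iterate of the standard conjugate gradient method applied to $Q^{-1/2}AD^2A^TQ^{-1/2}\tilde z=Q^{-1/2}p$ from $\tilde z^{0}=0$, and let $$v=(XS)^{1/2}W(ADW)^\dagger(AD^2A^T\Delta\tilde y-p),$$ with $\dagger$ the Moore–Penrose pseudoinverse. Then, with probability at least $1-\eta$, for every iteration count $t\ge C\max\{1,\log(n\mu/\delta)\}$ one has $$\|v\|_2\le\delta\qquad\text{and}\qquad AD^2A^T\Delta\tilde y=p+AS^{-1}v .$$ In particular $\mathcal O(\log(n\mu/\delta))$ PCG iterations suffice, with a constant that does not depend on the conditioning of $AD^2A^T$, and the pair $(\Delta\tilde y,v)$ meets the requirements on $\mathtt{Solve}^{\mathbf v}$. -/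

import Mathlib

open Matrix MeasureTheory

/-! ### Linear algebra -/

/-- The Euclidean norm of a real vector. -/
noncomputable def l2norm {k : ℕ} (v : Fin k → ℝ) : ℝ := ‖WithLp.toLp 2 v‖

/-- The spectral norm (operator norm induced by the Euclidean norm) of a square matrix. -/
noncomputable def specNorm {k : ℕ} (M : Matrix (Fin k) (Fin k) ℝ) : ℝ :=
  ‖Matrix.toEuclideanCLM (𝕜 := ℝ) M‖

/-- `M = U diag(σ) Vᵀ` is a thin singular value decomposition of the `m × n` matrix `M`
with `m` singular values. -/
structure IsThinSVD {m n : ℕ} (M : Matrix (Fin m) (Fin n) ℝ) (U : Matrix (Fin m) (Fin m) ℝ)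
    (σ : Fin m → ℝ) (V : Matrix (Fin n) (Fin m) ℝ) : Prop where
  left_orthonormal : Uᵀ * U = 1
  right_orthonormal : Vᵀ * V = 1
  nonneg : ∀ i, 0 ≤ σ i
  eq : M = U * diagonal σ * Vᵀ

/-- The spectral inverse of a real symmetric matrix: if `G = U diag(λ) Uᵀ` with `U` orthogonal,
this is `U diag(λ⁻¹) Uᵀ`, where zero eigenvalues are kept at zero (`0⁻¹ = 0`). -/
noncomputable def spectralInv {k : ℕ} (G : Matrix (Fin k) (Fin k) ℝ) : Matrix (Fin k) (Fin k) ℝ :=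
  cfc (fun t : ℝ => t⁻¹) G

/-- The inverse square root `Q^{-1/2} = U diag(λ^{-1/2}) Uᵀ` of a positive semidefinite matrix
`Q = U diag(λ) Uᵀ`. -/
noncomputable def invSqrt {k : ℕ} (Q : Matrix (Fin k) (Fin k) ℝ) : Matrix (Fin k) (Fin k) ℝ :=
  cfc (fun t : ℝ => (Real.sqrt t)⁻¹) Q

/-- The Moore-Penrose pseudoinverse, `M† = Mᵀ (M Mᵀ)†`; the four Penrose equations, which
characterise it, are verified in `isMoorePenrose_pinv`. -/
noncomputable def pinv {m w : ℕ} (M : Matrix (Fin m) (Fin w) ℝ) : Matrix (Fin w) (Fin m) ℝ :=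
  Mᵀ * spectralInv (M * Mᵀ)

/-- The four Penrose equations. -/
structure IsMoorePenrose {m w : ℕ} (M : Matrix (Fin m) (Fin w) ℝ)
    (X : Matrix (Fin w) (Fin m) ℝ) : Prop where
  mul_mul_left : M * X * M = M
  mul_mul_right : X * M * X = X
  symm_left : (M * X)ᵀ = M * X
  symm_right : (X * M)ᵀ = X * M

theorem isMoorePenrose_pinv {m w : ℕ} (M : Matrix (Fin m) (Fin w) ℝ) :
    IsMoorePenrose M (pinv M) := by
  set G := M * Mᵀ with hG
  set H := spectralInv G with hH
  have hGs : IsSelfAdjoint G := by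
    rw [IsSelfAdjoint, star_eq_conjTranspose, conjTranspose_eq_transpose_of_trivial, hG,
      transpose_mul, transpose_transpose]
  have hc : ∀ f : ℝ → ℝ, ContinuousOn f (spectrum ℝ G) := fun f =>
    (Matrix.finite_real_spectrum (A := G)).continuousOn f
  have hHt : Hᵀ = H := by
    have : IsSelfAdjoint H := cfc_predicate _ _
    rwa [IsSelfAdjoint, star_eq_conjTranspose, conjTranspose_eq_transpose_of_trivial] at this
  have hGt : Gᵀ = G := by rw [hG, transpose_mul, transpose_transpose]
  have hGH : G * H = H * G := by
    have := (cfc_commute_cfc (fun t : ℝ => t) (fun t : ℝ => t⁻¹) G).eq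
    rwa [cfc_id' ℝ G hGs] at this
  have h1 : G * H * G = G := by
    have e : cfc (fun t : ℝ => t * t⁻¹ * t) G = G := by
      conv_rhs => rw [← cfc_id' ℝ G hGs]
      congr 1
      funext t
      exact mul_inv_mul_cancel t
    rw [cfc_mul (fun t : ℝ => t * t⁻¹) (fun t => t) G (hc _) (hc _),
      cfc_mul (fun t : ℝ => t) (fun t => t⁻¹) G (hc _) (hc _), cfc_id' ℝ G hGs] at e
    exact e
  have h2 : H * G * H = H := by
    have e : cfc (fun t : ℝ => t⁻¹ * t * t⁻¹) G = H := by
      rw [hH, spectralInv]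
      congr 1
      funext t
      rcases eq_or_ne t 0 with h | h <;> simp [h]
    rw [cfc_mul (fun t : ℝ => t⁻¹ * t) (fun t => t⁻¹) G (hc _) (hc _),
      cfc_mul (fun t : ℝ => t⁻¹) (fun t => t) G (hc _) (hc _), cfc_id' ℝ G hGs] at e
    exact e
  have hX : pinv M = Mᵀ * H := rfl
  have hMX : M * pinv M = G * H := by rw [hX, ← Matrix.mul_assoc]
  refine ⟨?_, ?_, ?_, ?_⟩
  · rw [hMX]
    have hz : (G * H * M - M) * (G * H * M - M)ᴴ = 0 := by
      rw [conjTranspose_eq_transpose_of_trivial, transpose_sub, transpose_mul, transpose_mul,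
        hHt, hGt, Matrix.sub_mul, Matrix.mul_sub, Matrix.mul_sub]
      have a1 : G * H * M * (Mᵀ * (H * G)) = G * H * G * (H * G) := by
        simp only [hG, Matrix.mul_assoc]
      have a2 : G * H * M * Mᵀ = G * H * G := by simp only [hG, Matrix.mul_assoc]
      have a3 : M * (Mᵀ * (H * G)) = G * H * G := by simp only [hG, Matrix.mul_assoc]
      have a4 : G * (H * G) = G := by rw [← Matrix.mul_assoc, h1]
      rw [a1, a2, a3, ← hG, h1, a4]
      simp
    exact sub_eq_zero.mp (Matrix.self_mul_conjTranspose_eq_zero.mp hz)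
  · rw [Matrix.mul_assoc, hMX, hX, Matrix.mul_assoc, ← Matrix.mul_assoc H G H, h2]
  · rw [hMX, transpose_mul, hHt, hGt, hGH]
  · rw [hX, transpose_mul, transpose_mul, transpose_transpose, hHt, Matrix.mul_assoc]

/-! ### The conjugate gradient method -/

/-- The state of the conjugate gradient method: iterate, residual, search direction. -/
structure CGState (m : ℕ) where
  z : Fin m → ℝ
  r : Fin m → ℝ
  d : Fin m → ℝ

/-- One step of the standard (Hestenes-Stiefel) conjugate gradient method for `B z = b`. Once the
residual is zero the method has terminated; then both step lengths below are `0 / 0 = 0` and the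
state no longer changes its iterate. -/
noncomputable def cgStep {m : ℕ} (B : Matrix (Fin m) (Fin m) ℝ) (c : CGState m) : CGState m :=
  let α := (c.r ⬝ᵥ c.r) / (c.d ⬝ᵥ (B *ᵥ c.d))
  let r' := c.r - α • (B *ᵥ c.d)
  let β := (r' ⬝ᵥ r') / (c.r ⬝ᵥ c.r)
  { z := c.z + α • c.d
    r := r'
    d := r' + β • c.d }

/-- The iterate `z^t` after `t` steps of the conjugate gradient method for `B z = b`, started at
`z^0 = 0`. -/
noncomputable def cg {m : ℕ} (B : Matrix (Fin m) (Fin m) ℝ) (b : Fin m → ℝ) (t : ℕ) : Fin m → ℝ :=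
  ((cgStep B)^[t] { z := 0, r := b, d := b }).z

/-- The preconditioner `Q = (M W) (M W)ᵀ`; for `M = A D` this is `A D W Wᵀ D Aᵀ`. -/
def sketchPrecond {m n w : ℕ} (M : Matrix (Fin m) (Fin n) ℝ) (W : Matrix (Fin n) (Fin w) ℝ) :
    Matrix (Fin m) (Fin m) ℝ :=
  M * W * Wᵀ * Mᵀ

/-- Preconditioned conjugate gradient with input `M = A D`, right-hand side `p`, sketching matrix
`W` and iteration count `t`: run `t` steps of conjugate gradient on
`Q^{-1/2} M Mᵀ Q^{-1/2} z = Q^{-1/2} p` from `z = 0` and return `Q^{-1/2} z`. -/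
noncomputable def pcg {m n w : ℕ} (M : Matrix (Fin m) (Fin n) ℝ) (p : Fin m → ℝ)
    (W : Matrix (Fin n) (Fin w) ℝ) (t : ℕ) : Fin m → ℝ :=
  let R := invSqrt (sketchPrecond M W)
  R *ᵥ cg (R * (M * Mᵀ) * R) (R *ᵥ p) t

/-! ### Interior point quantities -/

/-- The duality measure `μ = xᵀ s / n`. -/
noncomputable def dualityMeasure {n : ℕ} (x s : Fin n → ℝ) : ℝ := (x ⬝ᵥ s) / n

/-- The `ℓ₂` neighbourhood of the central path, a set of triples `(x, y, s)`. -/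
def nbhdN2 (m n : ℕ) (θ : ℝ) : Set ((Fin n → ℝ) × (Fin m → ℝ) × (Fin n → ℝ)) :=
  {q | (∀ i, 0 < q.1 i) ∧ (∀ i, 0 < q.2.2 i) ∧
    l2norm (fun i => q.1 i * q.2.2 i - dualityMeasure q.1 q.2.2) ≤
      θ * dualityMeasure q.1 q.2.2}

/-- `D = X^{1/2} S^{-1/2}`. -/
noncomputable def scalingD {n : ℕ} (x s : Fin n → ℝ) : Matrix (Fin n) (Fin n) ℝ :=
  diagonal fun i => Real.sqrt (x i / s i)

/-- The right-hand side of the normal equations, `p = -σ μ A S⁻¹ 1 + A x`. -/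
noncomputable def rhsP {m n : ℕ} (A : Matrix (Fin m) (Fin n) ℝ) (x s : Fin n → ℝ) (σ : ℝ) :
    Fin m → ℝ :=
  -((σ * dualityMeasure x s) • (A *ᵥ fun i => (s i)⁻¹)) + A *ᵥ x

/-- The normal equations matrix `A D² Aᵀ`. -/
noncomputable def normalMatrix {m n : ℕ} (A : Matrix (Fin m) (Fin n) ℝ) (x s : Fin n → ℝ) :
    Matrix (Fin m) (Fin m) ℝ :=
  A * scalingD x s ^ 2 * Aᵀ

/-- The error-adjustment vector
`v = (X S)^{1/2} W (A D W)† (A D² Aᵀ Δy - p)`. -/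
noncomputable def adjustVec {m n w : ℕ} (A : Matrix (Fin m) (Fin n) ℝ) (x s : Fin n → ℝ)
    (p : Fin m → ℝ) (W : Matrix (Fin n) (Fin w) ℝ) (dy : Fin m → ℝ) : Fin n → ℝ :=
  (diagonal (fun i => Real.sqrt (x i * s i)) * W * pinv (A * scalingD x s * W)) *ᵥ
    (normalMatrix A x s *ᵥ dy - p)

/-! ### Sparse sketching matrices -/

/-- An `n × w` sparse sketching matrix with row sparsity `k`: every row has at most `k` nonzero
entries and is normalised to Euclidean length one. -/
structure IsSparseSketch {n w : ℕ} (k : ℕ) (W : Matrix (Fin n) (Fin w) ℝ) : Prop where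
  sparse : ∀ i, (Finset.univ.filter fun j => W i j ≠ 0).card ≤ k
  normalised : ∀ i, ∑ j, W i j ^ 2 = 1

/-- Matrices with exactly `k > 0` nonzero entries `±1/√k` in each row (the values taken by the
sparse random sign construction) are sparse sketching matrices. -/
theorem isSparseSketch_of_signs {n w k : ℕ} (hk : 0 < k) (W : Matrix (Fin n) (Fin w) ℝ)
    (hcard : ∀ i, (Finset.univ.filter fun j => W i j ≠ 0).card = k)
    (hval : ∀ i j, W i j ≠ 0 → W i j = 1 / Real.sqrt k ∨ W i j = -(1 / Real.sqrt k)) :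
    IsSparseSketch k W := by
  refine ⟨fun i => (hcard i).le, fun i => ?_⟩
  have hk' : (k : ℝ) ≠ 0 := by exact_mod_cast hk.ne'
  have h1 : ∑ j, W i j ^ 2 = ∑ j ∈ Finset.univ.filter (fun j => W i j ≠ 0), W i j ^ 2 := by
    rw [Finset.sum_filter]
    refine Finset.sum_congr rfl fun j _ => ?_
    by_cases h : W i j = 0 <;> simp [h]
  have h2 : ∀ j ∈ Finset.univ.filter (fun j => W i j ≠ 0), W i j ^ 2 = 1 / (k : ℝ) := by
    intro j hj
    have hs : (1 / Real.sqrt k) ^ 2 = 1 / (k : ℝ) := by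
      rw [div_pow, one_pow, Real.sq_sqrt (Nat.cast_nonneg k)]
    rcases hval i j (Finset.mem_filter.mp hj).2 with h | h
    · rw [h, hs]
    · rw [h, neg_sq, hs]
  rw [h1, Finset.sum_congr rfl h2, Finset.sum_const, hcard i, nsmul_eq_mul]
  field_simp

/-! Write `M = A D`, `Q = (M W)(M W)ᵀ` and `R = Q^{-1/2}`. Since `Mᵀ u = V a` with `a = Σ Uᵀ u`, the
embedding property gives `1/2 · M Mᵀ ≤ Q ≤ 3/2 · M Mᵀ` as quadratic forms. So `Q` is positive
definite and `R M Mᵀ R` has condition number at most 3, whatever that of `M Mᵀ`.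

Conjugate gradient then contracts the squared energy error by `2/3` per step. No Krylov optimality
or Chebyshev polynomial is needed: each step is an exact line search doing at least as well as
steepest descent, and this follows from the local relations in `CGInvariant`.

Two identities link this to `v`. First, `‖(M W)† q‖ = ‖R q‖`, so the pseudoinverse sees exactly the
residual of the preconditioned system. Second, `p = M g` with `g = scaledResidual`, where `‖g‖²` is
of order `n μ` in the neighbourhood. As `(X S)^{1/2}` contributes at most `(1 + θ) μ` and `W` at
most its squared Frobenius norm `n`, `‖v‖²` is at most a constant depending on `θ` times `(n μ)²
(2/3)^t`. Taking logarithms gives the iteration count.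

The adjustment identity is algebra: `S⁻¹ (X S)^{1/2} = D`, and `(M W)†` is a right inverse of `M W`
because `Q` is invertible. -/

/-! ### ### Energy decay of the conjugate gradient method -/

theorem dotProduct_mulVec_comm_of_transpose_eq {k : ℕ} {B : Matrix (Fin k) (Fin k) ℝ}
    (hB : Bᵀ = B) (u v : Fin k → ℝ) : u ⬝ᵥ B *ᵥ v = v ⬝ᵥ B *ᵥ u := by
  rw [dotProduct_mulVec, ← mulVec_transpose, hB, dotProduct_comm]

theorem dotProduct_self_nonneg_real {k : ℕ} (v : Fin k → ℝ) : 0 ≤ v ⬝ᵥ v :=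
  Finset.sum_nonneg fun i _ => mul_self_nonneg (v i)

/-- The relations between iterate, residual and search direction that every step of the conjugate
gradient method for `B z = B z₀` preserves. -/
structure CGInvariant {m : ℕ} (B : Matrix (Fin m) (Fin m) ℝ) (z₀ : Fin m → ℝ)
    (c : CGState m) : Prop where
  residual : c.r = B *ᵥ (z₀ - c.z)
  dir : c.r ⬝ᵥ c.d = c.r ⬝ᵥ c.r
  conj : c.r ⬝ᵥ B *ᵥ c.d = c.d ⬝ᵥ B *ᵥ c.d

/-- The squared energy norm of the error of a state. -/
def cgEnergy {m : ℕ} (B : Matrix (Fin m) (Fin m) ℝ) (z₀ : Fin m → ℝ) (c : CGState m) : ℝ :=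
  (z₀ - c.z) ⬝ᵥ B *ᵥ (z₀ - c.z)

section ConjugateGradient

variable {m : ℕ} {B : Matrix (Fin m) (Fin m) ℝ} {z₀ : Fin m → ℝ} {K L : ℝ}

theorem CGInvariant.init (B : Matrix (Fin m) (Fin m) ℝ) (z₀ : Fin m → ℝ) :
    CGInvariant B z₀ { z := 0, r := B *ᵥ z₀, d := B *ᵥ z₀ } := by
  constructor <;> simp

theorem CGInvariant.step (hB : Bᵀ = B) (hlo : ∀ z, z ⬝ᵥ z ≤ K * (z ⬝ᵥ B *ᵥ z))
    {c : CGState m} (h : CGInvariant B z₀ c) : CGInvariant B z₀ (cgStep B c) := by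
  obtain ⟨z, r, d⟩ := c
  obtain ⟨h1, h2, h3⟩ := h
  simp only at h1 h2 h3
  by_cases hd : d ⬝ᵥ B *ᵥ d = 0
  -- Breakdown happens only at termination: definiteness forces `d = 0`, hence `r = 0`, and the step
  -- lengths take the default value `0 / 0 = 0`.
  · have hd0 : d = 0 := by
      have := hlo d
      rw [hd, mul_zero] at this
      exact dotProduct_self_eq_zero.mp (le_antisymm this (dotProduct_self_nonneg_real d))
    subst hd0
    have hr0 : r = 0 := dotProduct_self_eq_zero.mp (by rw [← h2, dotProduct_zero])
    subst hr0
    constructor <;> simp [cgStep, ← h1]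
  · have hr : r ⬝ᵥ r ≠ 0 := fun hr => by
      have hr0 : r = 0 := dotProduct_self_eq_zero.mp hr
      rw [← h3, hr0, zero_dotProduct] at hd
      exact hd rfl
    set α := (r ⬝ᵥ r) / (d ⬝ᵥ B *ᵥ d) with hα
    set r' := r - α • B *ᵥ d with hr'
    set β := (r' ⬝ᵥ r') / (r ⬝ᵥ r) with hβ
    have hαd : α * (d ⬝ᵥ B *ᵥ d) = r ⬝ᵥ r := div_mul_cancel₀ _ hd
    have hβr : β * (r ⬝ᵥ r) = r' ⬝ᵥ r' := div_mul_cancel₀ _ hr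
    have hα0 : α ≠ 0 := div_ne_zero hr hd
    have e1 : r' ⬝ᵥ d = 0 := by
      rw [hr', sub_dotProduct, smul_dotProduct, dotProduct_comm (B *ᵥ d), h2, smul_eq_mul, hαd,
        sub_self]
    have e2 : r' ⬝ᵥ r = 0 := by
      rw [hr', sub_dotProduct, smul_dotProduct, dotProduct_comm (B *ᵥ d), h3, smul_eq_mul, hαd,
        sub_self]
    -- Substituting `r' = r - α B d` in one factor of `r' ⬝ᵥ r'` leaves only `-α (r' ⬝ᵥ B d)`. This
    -- is why the chosen `β` makes consecutive directions conjugate.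
    have e3 : r' ⬝ᵥ B *ᵥ d = -(β * (d ⬝ᵥ B *ᵥ d)) := by
      have : α * (r' ⬝ᵥ B *ᵥ d) = -(r' ⬝ᵥ r') := by
        conv_rhs => rw [hr', dotProduct_sub, ← hr', e2, dotProduct_smul, smul_eq_mul]
        ring
      apply mul_left_cancel₀ hα0
      rw [this, ← hβr, ← hαd]; ring
    have e4 : (r' + β • d) ⬝ᵥ B *ᵥ d = 0 := by
      rw [add_dotProduct, e3, smul_dotProduct, smul_eq_mul]; ring
    refine ⟨?_, ?_, ?_⟩
    · change r' = B *ᵥ (z₀ - (z + α • d))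
      rw [← sub_sub, mulVec_sub, ← h1, mulVec_smul]
    · change r' ⬝ᵥ (r' + β • d) = r' ⬝ᵥ r'
      rw [dotProduct_add, dotProduct_smul, e1, smul_zero, add_zero]
    · change r' ⬝ᵥ B *ᵥ (r' + β • d) = (r' + β • d) ⬝ᵥ B *ᵥ (r' + β • d)
      rw [add_dotProduct, smul_dotProduct, dotProduct_mulVec_comm_of_transpose_eq hB d, e4,
        smul_zero, add_zero]

/-- This is `B² ≤ L B`, read off from nonnegativity of the form of `B` at `L e - B e`. -/
theorem le_dotProduct_mulVec_of_bound (hB : Bᵀ = B)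
    (hpos : ∀ z, 0 ≤ z ⬝ᵥ B *ᵥ z) (hL : 0 < L) (hhi : ∀ z, z ⬝ᵥ B *ᵥ z ≤ L * (z ⬝ᵥ z))
    (e : Fin m → ℝ) : (B *ᵥ e) ⬝ᵥ (B *ᵥ e) ≤ L * (e ⬝ᵥ B *ᵥ e) := by
  set r := B *ᵥ e with hr
  have h := hpos (L • e - r)
  have e1 : r ⬝ᵥ B *ᵥ e = r ⬝ᵥ r := by rw [hr]
  have e2 : e ⬝ᵥ B *ᵥ r = r ⬝ᵥ r := by rw [dotProduct_mulVec_comm_of_transpose_eq hB, e1]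
  rw [mulVec_sub, mulVec_smul, sub_dotProduct, dotProduct_sub, dotProduct_sub, smul_dotProduct,
    smul_dotProduct, dotProduct_smul, dotProduct_smul, e1, e2, ← hr] at h
  simp only [smul_eq_mul] at h
  have h2 := hhi r
  have : 0 ≤ L * (L * (e ⬝ᵥ r) - r ⬝ᵥ r) := by linarith
  linarith [nonneg_of_mul_nonneg_right this hL]

/-- This is `B ≤ K B²`, read off from `0 ≤ ‖e - K B e‖²`. -/
theorem dotProduct_mulVec_le_of_bound (hK : 0 < K) (hlo : ∀ z, z ⬝ᵥ z ≤ K * (z ⬝ᵥ B *ᵥ z))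
    (e : Fin m → ℝ) : e ⬝ᵥ B *ᵥ e ≤ K * ((B *ᵥ e) ⬝ᵥ (B *ᵥ e)) := by
  set r := B *ᵥ e with hr
  have h := dotProduct_self_nonneg_real (e - K • r)
  rw [sub_dotProduct, dotProduct_sub, dotProduct_sub, smul_dotProduct,
    smul_dotProduct, dotProduct_smul, dotProduct_smul, dotProduct_comm r e] at h
  simp only [smul_eq_mul] at h
  have h2 := hlo e
  rw [← hr] at h2
  have : 0 ≤ K * (K * (r ⬝ᵥ r) - e ⬝ᵥ r) := by linarith
  linarith [nonneg_of_mul_nonneg_right this hK]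

/-- The line search along `d` lowers the energy by `(r ⬝ᵥ r)² / (d ⬝ᵥ B d)`. Conjugacy of `r - d` to
`d` gives `d ⬝ᵥ B d ≤ r ⬝ᵥ B r ≤ L (r ⬝ᵥ r)`, so the gain is at least `(r ⬝ᵥ r) / L`, and the energy
is at most `K (r ⬝ᵥ r)`. -/
theorem CGInvariant.energy_step (hB : Bᵀ = B) (hK : 0 < K) (hL : 0 < L)
    (hlo : ∀ z, z ⬝ᵥ z ≤ K * (z ⬝ᵥ B *ᵥ z)) (hhi : ∀ z, z ⬝ᵥ B *ᵥ z ≤ L * (z ⬝ᵥ z))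
    {c : CGState m} (h : CGInvariant B z₀ c) :
    cgEnergy B z₀ (cgStep B c) ≤ (1 - 1 / (K * L)) * cgEnergy B z₀ c := by
  have hpos : ∀ z, 0 ≤ z ⬝ᵥ B *ᵥ z := fun z =>
    nonneg_of_mul_nonneg_right ((dotProduct_self_nonneg_real z).trans (hlo z)) hK
  obtain ⟨z, r, d⟩ := c
  obtain ⟨h1, h2, h3⟩ := h
  simp only at h1 h2 h3
  have hdL : d ⬝ᵥ B *ᵥ d ≤ L * (r ⬝ᵥ r) := by
    have := hpos (d - r)
    rw [mulVec_sub, sub_dotProduct, dotProduct_sub, dotProduct_sub,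
      dotProduct_mulVec_comm_of_transpose_eq hB d r, h3] at this
    linarith [hhi r]
  have hE := dotProduct_mulVec_le_of_bound hK hlo (z₀ - z)
  rw [← h1] at hE
  set α := (r ⬝ᵥ r) / (d ⬝ᵥ B *ᵥ d) with hα
  change (z₀ - (z + α • d)) ⬝ᵥ B *ᵥ (z₀ - (z + α • d)) ≤
    (1 - 1 / (K * L)) * ((z₀ - z) ⬝ᵥ B *ᵥ (z₀ - z))
  have hexp : (z₀ - (z + α • d)) ⬝ᵥ B *ᵥ (z₀ - (z + α • d)) =
      (z₀ - z) ⬝ᵥ r - 2 * α * (r ⬝ᵥ r) + α ^ 2 * (d ⬝ᵥ B *ᵥ d) := by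
    rw [← sub_sub, mulVec_sub, sub_dotProduct, dotProduct_sub, dotProduct_sub, mulVec_smul,
      smul_dotProduct, smul_dotProduct, dotProduct_smul, dotProduct_smul,
      dotProduct_mulVec_comm_of_transpose_eq hB (z₀ - z) d, ← h1, dotProduct_comm d r, h2]
    simp only [smul_eq_mul]; ring
  rw [hexp, ← h1]
  have hgain : r ⬝ᵥ r ≤ L * (2 * α * (r ⬝ᵥ r) - α ^ 2 * (d ⬝ᵥ B *ᵥ d)) := by
    rcases eq_or_ne (d ⬝ᵥ B *ᵥ d) 0 with hd | hd
    · have hd0 : d = 0 := by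
        have := hlo d
        rw [hd, mul_zero] at this
        exact dotProduct_self_eq_zero.mp (le_antisymm this (dotProduct_self_nonneg_real d))
      have : r ⬝ᵥ r = 0 := by rw [← h2, hd0, dotProduct_zero]
      simp [this, hd]
    · have hdp : 0 < d ⬝ᵥ B *ᵥ d := lt_of_le_of_ne (hpos d) hd.symm
      have : 2 * α * (r ⬝ᵥ r) - α ^ 2 * (d ⬝ᵥ B *ᵥ d) = (r ⬝ᵥ r) ^ 2 / (d ⬝ᵥ B *ᵥ d) := by
        rw [hα]; field_simp; ring
      rw [this, ← mul_div_assoc, le_div_iff₀ hdp]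
      nlinarith [dotProduct_self_nonneg_real r]
  have hKL : 0 < K * L := mul_pos hK hL
  have : (1 / (K * L)) * ((z₀ - z) ⬝ᵥ r) ≤ 2 * α * (r ⬝ᵥ r) - α ^ 2 * (d ⬝ᵥ B *ᵥ d) := by
    rw [one_div_mul_eq_div, div_le_iff₀ hKL]
    nlinarith
  linarith

/-- Residual bound for the conjugate gradient method on a system with condition number at most
`K * L`. -/
theorem cg_residual_le (hB : Bᵀ = B) (hK : 0 < K) (hL : 0 < L) (hKL : 1 ≤ K * L)
    (hlo : ∀ z, z ⬝ᵥ z ≤ K * (z ⬝ᵥ B *ᵥ z)) (hhi : ∀ z, z ⬝ᵥ B *ᵥ z ≤ L * (z ⬝ᵥ z))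
    (b : Fin m → ℝ) (t : ℕ) :
    (b - B *ᵥ cg B b t) ⬝ᵥ (b - B *ᵥ cg B b t) ≤
      K * L * (1 - 1 / (K * L)) ^ t * (b ⬝ᵥ b) := by
  have hpos : ∀ z, 0 ≤ z ⬝ᵥ B *ᵥ z := fun z =>
    nonneg_of_mul_nonneg_right ((dotProduct_self_nonneg_real z).trans (hlo z)) hK
  have hinj : Function.Injective B.mulVec := by
    refine (injective_iff_map_eq_zero B.mulVecLin).mpr fun z hz => ?_
    have := hlo z
    rw [show B *ᵥ z = 0 from hz, dotProduct_zero, mul_zero] at this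
    exact dotProduct_self_eq_zero.mp (le_antisymm this (dotProduct_self_nonneg_real z))
  obtain ⟨z₀, rfl⟩ := mulVec_surjective_iff_isUnit.mpr (mulVec_injective_iff_isUnit.mp hinj) b
  have hρ : 0 ≤ 1 - 1 / (K * L) := by
    rw [sub_nonneg, div_le_one (by linarith)]; exact hKL
  set c₀ : CGState m := { z := 0, r := B *ᵥ z₀, d := B *ᵥ z₀ } with hc₀
  have key : ∀ t, CGInvariant B z₀ ((cgStep B)^[t] c₀) ∧
      cgEnergy B z₀ ((cgStep B)^[t] c₀) ≤ (1 - 1 / (K * L)) ^ t * cgEnergy B z₀ c₀ := by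
    intro t
    induction t with
    | zero => exact ⟨CGInvariant.init B z₀, by simp⟩
    | succ t ih =>
      rw [Function.iterate_succ_apply', pow_succ']
      refine ⟨ih.1.step hB hlo, (ih.1.energy_step hB hK hL hlo hhi).trans ?_⟩
      rw [mul_assoc]
      exact mul_le_mul_of_nonneg_left ih.2 hρ
  have hE0 : cgEnergy B z₀ c₀ ≤ K * ((B *ᵥ z₀) ⬝ᵥ (B *ᵥ z₀)) := by
    have := dotProduct_mulVec_le_of_bound hK hlo z₀
    simpa [cgEnergy, hc₀] using this
  -- The prefactor `K * L` is the cost of changing norms: `L` from energy to final residual, `K`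
  -- from initial residual to energy.
  have hres := le_dotProduct_mulVec_of_bound hB hpos hL hhi (z₀ - cg B (B *ᵥ z₀) t)
  rw [mulVec_sub] at hres
  refine hres.trans ?_
  rw [← mulVec_sub]
  change L * cgEnergy B z₀ ((cgStep B)^[t] c₀) ≤ _
  calc L * cgEnergy B z₀ ((cgStep B)^[t] c₀)
      ≤ L * ((1 - 1 / (K * L)) ^ t * (K * ((B *ᵥ z₀) ⬝ᵥ (B *ᵥ z₀)))) := by
        refine mul_le_mul_of_nonneg_left ((key t).2.trans ?_) hL.le
        exact mul_le_mul_of_nonneg_left hE0 (pow_nonneg hρ t)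
    _ = _ := by ring

end ConjugateGradient

/-! ### The inverse square root -/

section InvSqrt

variable {k : ℕ} {Q : Matrix (Fin k) (Fin k) ℝ}

theorem transpose_invSqrt (Q : Matrix (Fin k) (Fin k) ℝ) : (invSqrt Q)ᵀ = invSqrt Q := by
  have : IsSelfAdjoint (invSqrt Q) := cfc_predicate _ _
  rwa [IsSelfAdjoint, star_eq_conjTranspose, conjTranspose_eq_transpose_of_trivial] at this

theorem Matrix.PosDef.pos_of_mem_spectrum (hQ : Q.PosDef) {t : ℝ} (ht : t ∈ spectrum ℝ Q) :
    0 < t := by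
  rw [hQ.1.spectrum_real_eq_range_eigenvalues] at ht
  obtain ⟨i, rfl⟩ := ht
  exact hQ.eigenvalues_pos i

theorem invSqrt_mul_mul_invSqrt (hQ : Q.PosDef) : invSqrt Q * Q * invSqrt Q = 1 := by
  have hs : IsSelfAdjoint Q := hQ.1
  have hc : ∀ f : ℝ → ℝ, ContinuousOn f (spectrum ℝ Q) := fun f =>
    (Matrix.finite_real_spectrum (A := Q)).continuousOn f
  have e : cfc (fun t : ℝ => (Real.sqrt t)⁻¹ * t * (Real.sqrt t)⁻¹) Q = 1 := by
    rw [← cfc_one ℝ Q hs]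
    refine cfc_congr fun t ht => ?_
    have h0 := hQ.pos_of_mem_spectrum ht
    have h1 : Real.sqrt t ≠ 0 := (Real.sqrt_pos.mpr h0).ne'
    have h2 : t = Real.sqrt t * Real.sqrt t := (Real.mul_self_sqrt h0.le).symm
    change (Real.sqrt t)⁻¹ * t * (Real.sqrt t)⁻¹ = 1
    field_simp
    rw [sq]; exact h2
  rwa [cfc_mul (fun t : ℝ => (Real.sqrt t)⁻¹ * t) _ Q (hc _) (hc _),
    cfc_mul _ (fun t : ℝ => t) Q (hc _) (hc _), cfc_id' ℝ Q hs] at e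

theorem mul_invSqrt_mul_invSqrt (hQ : Q.PosDef) : Q * (invSqrt Q * invSqrt Q) = 1 := by
  rw [← Matrix.mul_assoc, mul_eq_one_comm, ← Matrix.mul_assoc, invSqrt_mul_mul_invSqrt hQ]

theorem spectralInv_eq_invSqrt_mul_invSqrt (hQ : Q.PosDef) :
    spectralInv Q = invSqrt Q * invSqrt Q := by
  have hc : ∀ f : ℝ → ℝ, ContinuousOn f (spectrum ℝ Q) := fun f =>
    (Matrix.finite_real_spectrum (A := Q)).continuousOn f
  rw [spectralInv, invSqrt, ← cfc_mul _ _ Q (hc _) (hc _)]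
  refine cfc_congr fun t ht => ?_
  change t⁻¹ = (Real.sqrt t)⁻¹ * (Real.sqrt t)⁻¹
  rw [← mul_inv, Real.mul_self_sqrt (hQ.pos_of_mem_spectrum ht).le]

end InvSqrt

/-! ### Euclidean norms and quadratic forms -/

theorem l2norm_sq {k : ℕ} (v : Fin k → ℝ) : l2norm v ^ 2 = v ⬝ᵥ v := by
  rw [l2norm, EuclideanSpace.real_norm_sq_eq]
  exact Finset.sum_congr rfl fun i _ => sq (v i)

theorem mulVec_dotProduct_mulVec {k l : ℕ} (M : Matrix (Fin k) (Fin l) ℝ) (u v : Fin l → ℝ) :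
    (M *ᵥ u) ⬝ᵥ (M *ᵥ v) = u ⬝ᵥ (Mᵀ * M) *ᵥ v := by
  rw [dotProduct_mulVec, ← mulVec_transpose, mulVec_mulVec, dotProduct_comm,
    dotProduct_mulVec_comm_of_transpose_eq (by rw [transpose_mul, transpose_transpose])]

theorem abs_dotProduct_mulVec_le_specNorm {k : ℕ} (M : Matrix (Fin k) (Fin k) ℝ)
    (a : Fin k → ℝ) : |a ⬝ᵥ M *ᵥ a| ≤ specNorm M * (a ⬝ᵥ a) := by
  have h1 := abs_real_inner_le_norm (Matrix.toEuclideanCLM (𝕜 := ℝ) M (WithLp.toLp 2 a))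
    (WithLp.toLp 2 a)
  rw [Matrix.toEuclideanCLM_toLp, EuclideanSpace.inner_toLp_toLp, star_trivial] at h1
  rw [← Matrix.toEuclideanCLM_toLp] at h1
  refine h1.trans ?_
  rw [← l2norm_sq, l2norm, sq, ← mul_assoc]
  exact mul_le_mul_of_nonneg_right (ContinuousLinearMap.le_opNorm _ _) (norm_nonneg _)

/-- Cauchy-Schwarz: the squared length of `M v` is at most the squared Frobenius norm of `M` times
the squared length of `v`. -/
theorem mulVec_dotProduct_self_le {k l : ℕ} (M : Matrix (Fin k) (Fin l) ℝ) (v : Fin l → ℝ) :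
    (M *ᵥ v) ⬝ᵥ (M *ᵥ v) ≤ (∑ i, ∑ j, M i j ^ 2) * (v ⬝ᵥ v) := by
  rw [Finset.sum_mul]
  refine Finset.sum_le_sum fun i _ => ?_
  have := Finset.sum_mul_sq_le_sq_mul_sq Finset.univ (M i) v
  rw [← sq]
  refine this.trans_eq ?_
  congr 1
  exact Finset.sum_congr rfl fun j _ => sq (v j)

theorem diagonal_mulVec_dotProduct_self_le {k : ℕ} {a : Fin k → ℝ} {c : ℝ}
    (ha : ∀ i, a i ^ 2 ≤ c) (v : Fin k → ℝ) :
    (diagonal a *ᵥ v) ⬝ᵥ (diagonal a *ᵥ v) ≤ c * (v ⬝ᵥ v) := by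
  simp only [dotProduct, mulVec_diagonal]
  rw [Finset.mul_sum]
  refine Finset.sum_le_sum fun i _ => ?_
  nlinarith [mul_le_mul_of_nonneg_right (ha i) (mul_self_nonneg (v i))]

theorem transpose_mulVec_injective_of_rank_eq {m n : ℕ} {A : Matrix (Fin m) (Fin n) ℝ}
    (hA : A.rank = m) : Function.Injective Aᵀ.mulVec := by
  have h : LinearIndependent ℝ A.row := by
    rw [linearIndependent_iff_card_eq_finrank_span, Set.finrank, ← rank_eq_finrank_span_row, hA,
      Fintype.card_fin]
  have := Matrix.vecMul_injective_iff.mpr h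
  intro u v huv
  apply this
  simpa only [mulVec_transpose] using huv

/-! ### The sketched preconditioner -/

section Precond

variable {m n w : ℕ} {M : Matrix (Fin m) (Fin n) ℝ} {W : Matrix (Fin n) (Fin w) ℝ}

theorem sketchPrecond_eq (M : Matrix (Fin m) (Fin n) ℝ) (W : Matrix (Fin n) (Fin w) ℝ) :
    sketchPrecond M W = M * W * (M * W)ᵀ := by
  rw [sketchPrecond, transpose_mul]; simp only [Matrix.mul_assoc]

/-- The subspace embedding property makes the sketched Gram matrix spectrally equivalent to the
exact one. -/
theorem IsThinSVD.sketchPrecond_bounds {U : Matrix (Fin m) (Fin m) ℝ} {sv : Fin m → ℝ}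
    {V : Matrix (Fin n) (Fin m) ℝ} {ε : ℝ} (h : IsThinSVD M U sv V)
    (hε : specNorm (Vᵀ * W * Wᵀ * V - 1) ≤ ε) (u : Fin m → ℝ) :
    (1 - ε) * (u ⬝ᵥ (M * Mᵀ) *ᵥ u) ≤ u ⬝ᵥ sketchPrecond M W *ᵥ u ∧
      u ⬝ᵥ sketchPrecond M W *ᵥ u ≤ (1 + ε) * (u ⬝ᵥ (M * Mᵀ) *ᵥ u) := by
  -- In the coordinates `a`, where `Mᵀ u = V a`, the exact form is `‖a‖²` and the sketched one is
  -- the form of `Vᵀ W Wᵀ V`.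
  set a := (diagonal sv * Uᵀ) *ᵥ u with ha
  have hM : Mᵀ = V * (diagonal sv * Uᵀ) := by
    rw [h.eq, transpose_mul, transpose_mul, transpose_transpose, diagonal_transpose]
  have hN : u ⬝ᵥ (M * Mᵀ) *ᵥ u = a ⬝ᵥ a := by
    have e := mulVec_dotProduct_mulVec Mᵀ u u
    rw [transpose_transpose] at e
    rw [← e, hM, ← mulVec_mulVec, mulVec_dotProduct_mulVec, h.right_orthonormal, one_mulVec]
  have hQ : u ⬝ᵥ sketchPrecond M W *ᵥ u = a ⬝ᵥ (Vᵀ * W * Wᵀ * V) *ᵥ a := by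
    have e := mulVec_dotProduct_mulVec (M * W)ᵀ u u
    rw [transpose_transpose, ← sketchPrecond_eq] at e
    rw [← e, transpose_mul, hM, ← Matrix.mul_assoc, ← mulVec_mulVec, ← ha,
      mulVec_dotProduct_mulVec, transpose_mul, transpose_transpose]
    simp only [Matrix.mul_assoc]
  have hle := (abs_dotProduct_mulVec_le_specNorm (Vᵀ * W * Wᵀ * V - 1) a).trans
    (mul_le_mul_of_nonneg_right hε (dotProduct_self_nonneg_real a))
  rw [sub_mulVec, dotProduct_sub, one_mulVec, abs_le] at hle
  rw [hN, hQ]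
  constructor <;> linarith [hle.1, hle.2]

theorem posDef_sketchPrecond (hM : Function.Injective Mᵀ.mulVec) {c : ℝ} (hc : 0 < c)
    (h : ∀ u, c * (u ⬝ᵥ (M * Mᵀ) *ᵥ u) ≤ u ⬝ᵥ sketchPrecond M W *ᵥ u) :
    (sketchPrecond M W).PosDef := by
  refine posDef_iff_dotProduct_mulVec.mpr ⟨?_, fun {u} hu => ?_⟩
  · rw [IsHermitian, conjTranspose_eq_transpose_of_trivial, sketchPrecond_eq, transpose_mul,
      transpose_transpose]
  · rw [star_trivial]
    refine lt_of_lt_of_le (mul_pos hc ?_) (h u)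
    have e := mulVec_dotProduct_mulVec Mᵀ u u
    rw [transpose_transpose] at e
    rw [← e]
    refine lt_of_le_of_ne (dotProduct_self_nonneg_real _) fun h0 => hu (hM ?_)
    rw [dotProduct_self_eq_zero.mp h0.symm, mulVec_zero]

theorem mul_pinv_of_posDef (hQ : (sketchPrecond M W).PosDef) : M * W * pinv (M * W) = 1 := by
  rw [pinv, ← Matrix.mul_assoc, ← sketchPrecond_eq, spectralInv_eq_invSqrt_mul_invSqrt hQ,
    mul_invSqrt_mul_invSqrt hQ]

/-- With `R = Q^{-1/2}`, the pseudoinverse is `(M W)ᵀ R²`, and `R Q R = 1` collapses its Gram matrix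
to `R²`. The adjustment vector is thus controlled by the residual that conjugate gradient reduces.
-/
theorem pinv_mulVec_dotProduct_self (hQ : (sketchPrecond M W).PosDef) (q : Fin m → ℝ) :
    (pinv (M * W) *ᵥ q) ⬝ᵥ (pinv (M * W) *ᵥ q) =
      (invSqrt (sketchPrecond M W) *ᵥ q) ⬝ᵥ (invSqrt (sketchPrecond M W) *ᵥ q) := by
  set R := invSqrt (sketchPrecond M W) with hR
  have hRt : Rᵀ = R := transpose_invSqrt _
  have e : pinv (M * W) = (M * W)ᵀ * R * R := by
    rw [pinv, ← sketchPrecond_eq, spectralInv_eq_invSqrt_mul_invSqrt hQ, Matrix.mul_assoc]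
  rw [e, ← mulVec_mulVec, mulVec_dotProduct_mulVec, transpose_mul, transpose_transpose, hRt]
  rw [show R * (M * W) * ((M * W)ᵀ * R) = R * sketchPrecond M W * R by
    rw [sketchPrecond_eq]; simp only [Matrix.mul_assoc], invSqrt_mul_mul_invSqrt hQ, one_mulVec]

variable {K L : ℝ}

/-- Substitute `u = R z` in the comparison of forms and use `R Q R = 1`. -/
theorem precond_lower (hQ : (sketchPrecond M W).PosDef)
    (h : ∀ u, u ⬝ᵥ sketchPrecond M W *ᵥ u ≤ K * (u ⬝ᵥ (M * Mᵀ) *ᵥ u)) (z : Fin m → ℝ) :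
    z ⬝ᵥ z ≤ K * (z ⬝ᵥ (invSqrt (sketchPrecond M W) * (M * Mᵀ) *
      invSqrt (sketchPrecond M W)) *ᵥ z) := by
  set R := invSqrt (sketchPrecond M W) with hR
  have hRt : Rᵀ = R := transpose_invSqrt _
  have key : ∀ X : Matrix (Fin m) (Fin m) ℝ, (R *ᵥ z) ⬝ᵥ X *ᵥ (R *ᵥ z) =
      z ⬝ᵥ (R * X * R) *ᵥ z := fun X => by
    rw [← mulVec_mulVec, ← mulVec_mulVec, dotProduct_mulVec z R, ← mulVec_transpose, hRt]
  have := h (R *ᵥ z)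
  rwa [key, key, invSqrt_mul_mul_invSqrt hQ, one_mulVec] at this

theorem precond_upper (hQ : (sketchPrecond M W).PosDef)
    (h : ∀ u, u ⬝ᵥ (M * Mᵀ) *ᵥ u ≤ L * (u ⬝ᵥ sketchPrecond M W *ᵥ u)) (z : Fin m → ℝ) :
    z ⬝ᵥ (invSqrt (sketchPrecond M W) * (M * Mᵀ) * invSqrt (sketchPrecond M W)) *ᵥ z ≤
      L * (z ⬝ᵥ z) := by
  set R := invSqrt (sketchPrecond M W) with hR
  have hRt : Rᵀ = R := transpose_invSqrt _
  have key : ∀ X : Matrix (Fin m) (Fin m) ℝ, (R *ᵥ z) ⬝ᵥ X *ᵥ (R *ᵥ z) =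
      z ⬝ᵥ (R * X * R) *ᵥ z := fun X => by
    rw [← mulVec_mulVec, ← mulVec_mulVec, dotProduct_mulVec z R, ← mulVec_transpose, hRt]
  have := h (R *ᵥ z)
  rwa [key, key, invSqrt_mul_mul_invSqrt hQ, one_mulVec] at this

/-- A bound on `X Xᵀ` passes to `Xᵀ X`: expand `0 ≤ ‖L g - Xᵀ X g‖²`. -/
theorem mulVec_dotProduct_self_le_of_gram_le {k l : ℕ} {X : Matrix (Fin k) (Fin l) ℝ}
    (hL : 0 < L) (h : ∀ z, z ⬝ᵥ (X * Xᵀ) *ᵥ z ≤ L * (z ⬝ᵥ z)) (g : Fin l → ℝ) :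
    (X *ᵥ g) ⬝ᵥ (X *ᵥ g) ≤ L * (g ⬝ᵥ g) := by
  set u := X *ᵥ g with hu
  have h1 := h u
  have e := mulVec_dotProduct_mulVec Xᵀ u u
  rw [transpose_transpose] at e
  rw [← e] at h1
  have e2 : g ⬝ᵥ Xᵀ *ᵥ u = u ⬝ᵥ u := by
    rw [dotProduct_mulVec, vecMul_transpose]
  have h2 := dotProduct_self_nonneg_real (L • g - Xᵀ *ᵥ u)
  rw [sub_dotProduct, dotProduct_sub, dotProduct_sub, smul_dotProduct, smul_dotProduct,
    dotProduct_smul, dotProduct_smul, dotProduct_comm (Xᵀ *ᵥ u) g, e2] at h2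
  simp only [smul_eq_mul] at h2
  have : 0 ≤ L * (L * (g ⬝ᵥ g) - u ⬝ᵥ u) := by linarith
  linarith [nonneg_of_mul_nonneg_right this hL]

/-- Error bound for preconditioned conjugate gradient with right-hand side `M g`, measured through
the pseudoinverse of the sketched matrix. -/
theorem pinv_mulVec_pcg_residual_le (hQ : (sketchPrecond M W).PosDef) (hK : 0 < K) (hL : 0 < L)
    (hKL : 1 ≤ K * L)
    (hlo : ∀ u, u ⬝ᵥ sketchPrecond M W *ᵥ u ≤ K * (u ⬝ᵥ (M * Mᵀ) *ᵥ u))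
    (hhi : ∀ u, u ⬝ᵥ (M * Mᵀ) *ᵥ u ≤ L * (u ⬝ᵥ sketchPrecond M W *ᵥ u))
    (g : Fin n → ℝ) (t : ℕ) :
    (pinv (M * W) *ᵥ ((M * Mᵀ) *ᵥ pcg M (M *ᵥ g) W t - M *ᵥ g)) ⬝ᵥ
      (pinv (M * W) *ᵥ ((M * Mᵀ) *ᵥ pcg M (M *ᵥ g) W t - M *ᵥ g)) ≤
      K * L * (1 - 1 / (K * L)) ^ t * (L * (g ⬝ᵥ g)) := by
  have hlo' := precond_lower hQ hlo
  have hhi' := precond_upper hQ hhi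
  rw [pinv_mulVec_dotProduct_self hQ, pcg]
  set R := invSqrt (sketchPrecond M W) with hR
  have hRt : Rᵀ = R := transpose_invSqrt _
  set B := R * (M * Mᵀ) * R with hB
  have hBt : Bᵀ = B := by
    rw [hB]
    simp only [transpose_mul, transpose_transpose, hRt, Matrix.mul_assoc]
  have hBX : B = (R * M) * (R * M)ᵀ := by
    rw [hB, transpose_mul, hRt]; simp only [Matrix.mul_assoc]
  have hcg := cg_residual_le hBt hK hL hKL hlo' hhi' (R *ᵥ M *ᵥ g) t
  set z := cg B (R *ᵥ M *ᵥ g) t with hz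
  have e : R *ᵥ ((M * Mᵀ) *ᵥ R *ᵥ z - M *ᵥ g) = -(R *ᵥ M *ᵥ g - B *ᵥ z) := by
    rw [mulVec_sub, neg_sub, hB]
    simp only [mulVec_mulVec, Matrix.mul_assoc]
  rw [e, neg_dotProduct, dotProduct_neg, neg_neg]
  -- The right-hand side is `R M g`, and `(R M)(R M)ᵀ = B ≤ L` bounds its squared length by `L
  -- ‖g‖²`.
  refine hcg.trans (mul_le_mul_of_nonneg_left ?_ ?_)
  · rw [mulVec_mulVec]
    exact mulVec_dotProduct_self_le_of_gram_le hL (by rwa [← hBX]) g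
  · have : 0 ≤ 1 - 1 / (K * L) := by
      rw [sub_nonneg, div_le_one (by linarith)]; exact hKL
    positivity

end Precond

/-! ### The central path neighbourhood -/

section Neighbourhood

variable {m n : ℕ} {θ : ℝ} {x s : Fin n → ℝ} {y : Fin m → ℝ}

theorem abs_mul_sub_le_of_mem_nbhdN2 (h : (x, y, s) ∈ nbhdN2 m n θ) (i : Fin n) :
    |x i * s i - dualityMeasure x s| ≤ θ * dualityMeasure x s := by
  refine le_trans ?_ h.2.2
  rw [l2norm]
  exact PiLp.norm_apply_le (WithLp.toLp 2 fun i => x i * s i - dualityMeasure x s) i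

theorem dualityMeasure_nonneg_of_mem_nbhdN2 (h : (x, y, s) ∈ nbhdN2 m n θ) :
    0 ≤ dualityMeasure x s :=
  div_nonneg (Finset.sum_nonneg fun i _ => (mul_pos (h.1 i) (h.2.1 i)).le) (Nat.cast_nonneg n)

theorem dualityMeasure_pos_of_mem_nbhdN2 (h : (x, y, s) ∈ nbhdN2 m n θ) (hn : 0 < n) :
    0 < dualityMeasure x s := by
  have : Nonempty (Fin n) := ⟨⟨0, hn⟩⟩
  exact div_pos (Finset.sum_pos (fun i _ => mul_pos (h.1 i) (h.2.1 i)) Finset.univ_nonempty)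
    (Nat.cast_pos.mpr hn)

theorem normalMatrix_eq (A : Matrix (Fin m) (Fin n) ℝ) (x s : Fin n → ℝ) :
    normalMatrix A x s = A * scalingD x s * (A * scalingD x s)ᵀ := by
  rw [normalMatrix, transpose_mul, scalingD, diagonal_transpose, sq]
  simp only [Matrix.mul_assoc]

/-- The vector `(X S)^{1/2} 1 - σ μ (X S)^{-1/2} 1`, whose image under `A D` is the right-hand
side of the normal equations. -/
noncomputable def scaledResidual (x s : Fin n → ℝ) (σ : ℝ) : Fin n → ℝ := fun i =>
  Real.sqrt (x i * s i) - σ * dualityMeasure x s / Real.sqrt (x i * s i)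

theorem sqrt_div_eq {a b : ℝ} (hb : 0 < b) : Real.sqrt (a / b) = b⁻¹ * Real.sqrt (a * b) := by
  rw [show a / b = a * b / b ^ 2 by field_simp, Real.sqrt_div' _ (sq_nonneg b),
    Real.sqrt_sq hb.le, div_eq_inv_mul]

theorem mul_diagonal_inv_mul_diagonal_sqrt (A : Matrix (Fin m) (Fin n) ℝ) (hs : ∀ i, 0 < s i) :
    A * (diagonal fun i => (s i)⁻¹) * (diagonal fun i => Real.sqrt (x i * s i)) =
      A * scalingD x s := by
  rw [Matrix.mul_assoc, diagonal_mul_diagonal, scalingD]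
  congr 2
  funext i
  exact (sqrt_div_eq (hs i)).symm

theorem rhsP_eq_mulVec (A : Matrix (Fin m) (Fin n) ℝ) (hx : ∀ i, 0 < x i) (hs : ∀ i, 0 < s i)
    (σ : ℝ) : rhsP A x s σ = (A * scalingD x s) *ᵥ scaledResidual x s σ := by
  rw [rhsP, ← mulVec_smul, neg_add_eq_sub, ← mulVec_sub, ← mulVec_mulVec]
  congr 1
  funext i
  have hp := mul_pos (hx i) (hs i)
  have h0 : Real.sqrt (x i * s i) ≠ 0 := (Real.sqrt_pos.mpr hp).ne'
  have h1 : Real.sqrt (x i * s i) * Real.sqrt (x i * s i) = x i * s i := Real.mul_self_sqrt hp.le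
  have hs0 := (hs i).ne'
  rw [scalingD, mulVec_diagonal, sqrt_div_eq (hs i), scaledResidual, Pi.sub_apply, Pi.smul_apply,
    smul_eq_mul, mul_sub,
    mul_assoc _ (Real.sqrt (x i * s i)) (Real.sqrt (x i * s i)), h1]
  field_simp

/-- With `a = x i * s i`, each squared coordinate is `(a - σ μ)² / a`. Since `a` lies between `(1 -
θ) μ` and `(1 + θ) μ` and `σ` in `[0, 1]`, the numerator is at most `((1 + θ) μ)²`. -/
theorem scaledResidual_dotProduct_self_le (hθ1 : θ < 1) (h : (x, y, s) ∈ nbhdN2 m n θ) {σ : ℝ}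
    (hσ0 : 0 ≤ σ) (hσ1 : σ ≤ 1) :
    scaledResidual x s σ ⬝ᵥ scaledResidual x s σ ≤
      n * ((1 + θ) ^ 2 * dualityMeasure x s / (1 - θ)) := by
  have : ∀ i ∈ Finset.univ, scaledResidual x s σ i * scaledResidual x s σ i ≤
      (1 + θ) ^ 2 * dualityMeasure x s / (1 - θ) := by
    intro i _
    have hp := mul_pos (h.1 i) (h.2.1 i)
    simp only at hp
    have hμ := dualityMeasure_nonneg_of_mem_nbhdN2 h
    have hi := abs_le.mp (abs_mul_sub_le_of_mem_nbhdN2 h i)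
    rw [scaledResidual]
    set μ := dualityMeasure x s
    set a := x i * s i
    have h0 : 0 < Real.sqrt a := Real.sqrt_pos.mpr hp
    have h1 : Real.sqrt a ^ 2 = a := Real.sq_sqrt hp.le
    have e : (Real.sqrt a - σ * μ / Real.sqrt a) * (Real.sqrt a - σ * μ / Real.sqrt a) =
        (a - σ * μ) ^ 2 / a := by
      rw [← h1]
      simp only [Real.sqrt_sq h0.le]
      field_simp
    have hσμ0 := mul_nonneg hσ0 hμ
    have hσμ1 := mul_le_mul_of_nonneg_right hσ1 hμ
    have hθμ : 0 ≤ θ * μ := (abs_nonneg _).trans (abs_mul_sub_le_of_mem_nbhdN2 h i)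
    have hsq : (a - σ * μ) ^ 2 ≤ ((1 + θ) * μ) ^ 2 := by
      apply sq_le_sq'
      · nlinarith
      · nlinarith
    rw [e, div_le_div_iff₀ hp (by linarith)]
    calc (a - σ * μ) ^ 2 * (1 - θ) ≤ ((1 + θ) * μ) ^ 2 * (1 - θ) :=
          mul_le_mul_of_nonneg_right hsq (by linarith)
      _ = (1 + θ) ^ 2 * μ * ((1 - θ) * μ) := by ring
      _ ≤ (1 + θ) ^ 2 * μ * a :=
          mul_le_mul_of_nonneg_left (by linarith) (mul_nonneg (sq_nonneg _) hμ)
  refine (Finset.sum_le_sum this).trans_eq ?_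
  rw [Finset.sum_const, Finset.card_univ, Fintype.card_fin, nsmul_eq_mul]

end Neighbourhood

/-! ### Correctness of the inexact solver -/

section Solver

variable {m n w k : ℕ} {A : Matrix (Fin m) (Fin n) ℝ} {x s : Fin n → ℝ} {y : Fin m → ℝ}
  {θ σ ε : ℝ} {W : Matrix (Fin n) (Fin w) ℝ}

theorem scalingD_transpose_mulVec_injective (hA : A.rank = m) (hx : ∀ i, 0 < x i)
    (hs : ∀ i, 0 < s i) : Function.Injective (A * scalingD x s)ᵀ.mulVec := by
  intro u v huv
  apply transpose_mulVec_injective_of_rank_eq hA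
  simp only [transpose_mul, scalingD, diagonal_transpose, ← mulVec_mulVec] at huv
  funext i
  have := congrFun huv i
  rw [mulVec_diagonal, mulVec_diagonal] at this
  exact mul_left_cancel₀ (Real.sqrt_pos.mpr (div_pos (hx i) (hs i))).ne' this

theorem normalMatrix_mulVec_eq_add_adjustVec (hs : ∀ i, 0 < s i)
    (hQ : (sketchPrecond (A * scalingD x s) W).PosDef) (p dy : Fin m → ℝ) :
    normalMatrix A x s *ᵥ dy =
      p + (A * diagonal fun i => (s i)⁻¹) *ᵥ adjustVec A x s p W dy := by
  rw [adjustVec, mulVec_mulVec, ← Matrix.mul_assoc, ← Matrix.mul_assoc,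
    mul_diagonal_inv_mul_diagonal_sqrt A hs, mul_pinv_of_posDef hQ, one_mulVec,
    add_sub_cancel]

/-- The diagonal factor squares to at most `(1 + θ) μ`; the factor `n` is the squared Frobenius norm
of `W`, whose `n` rows have length one. -/
theorem adjustVec_dotProduct_self_le (h : (x, y, s) ∈ nbhdN2 m n θ) (hθ0 : 0 ≤ θ)
    (hW : IsSparseSketch k W) (p dy : Fin m → ℝ) :
    adjustVec A x s p W dy ⬝ᵥ adjustVec A x s p W dy ≤
      (1 + θ) * dualityMeasure x s * (n *
        ((pinv (A * scalingD x s * W) *ᵥ (normalMatrix A x s *ᵥ dy - p)) ⬝ᵥ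
          (pinv (A * scalingD x s * W) *ᵥ (normalMatrix A x s *ᵥ dy - p)))) := by
  have hμ := dualityMeasure_nonneg_of_mem_nbhdN2 h
  rw [adjustVec, Matrix.mul_assoc, ← mulVec_mulVec, ← mulVec_mulVec]
  refine (diagonal_mulVec_dotProduct_self_le (c := (1 + θ) * dualityMeasure x s)
    (fun i => ?_) _).trans (mul_le_mul_of_nonneg_left ?_ (mul_nonneg (by linarith) hμ))
  · rw [Real.sq_sqrt (mul_pos (h.1 i) (h.2.1 i)).le]
    linarith [(abs_le.mp (abs_mul_sub_le_of_mem_nbhdN2 h i)).2]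
  · refine (mulVec_dotProduct_self_le W _).trans_eq ?_
    simp [hW.normalised]

/-- For every realisation of the sketch with the subspace embedding property, the exact adjustment
identity holds and the adjustment vector decays geometrically. -/
theorem adjustVec_pcg (hA : A.rank = m) (hθ0 : 0 ≤ θ) (hθ1 : θ < 1)
    (h : (x, y, s) ∈ nbhdN2 m n θ) {U : Matrix (Fin m) (Fin m) ℝ} {sv : Fin m → ℝ}
    {V : Matrix (Fin n) (Fin m) ℝ} (hsvd : IsThinSVD (A * scalingD x s) U sv V)
    (hσ0 : 0 ≤ σ) (hσ1 : σ ≤ 1) (hW : IsSparseSketch k W)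
    (hε : specNorm (Vᵀ * W * Wᵀ * V - 1) ≤ 1 / 2) (t : ℕ) :
    l2norm (adjustVec A x s (rhsP A x s σ) W
        (pcg (A * scalingD x s) (rhsP A x s σ) W t)) ^ 2 ≤
      6 * (1 + θ) ^ 3 / (1 - θ) * (n * dualityMeasure x s) ^ 2 * (2 / 3) ^ t ∧
    normalMatrix A x s *ᵥ pcg (A * scalingD x s) (rhsP A x s σ) W t =
      rhsP A x s σ + (A * diagonal fun i => (s i)⁻¹) *ᵥ adjustVec A x s (rhsP A x s σ) W
        (pcg (A * scalingD x s) (rhsP A x s σ) W t) := by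
  have hb := fun u => hsvd.sketchPrecond_bounds hε u
  have hQ : (sketchPrecond (A * scalingD x s) W).PosDef :=
    posDef_sketchPrecond (scalingD_transpose_mulVec_injective hA h.1 h.2.1)
      (c := 1 - 1 / 2) (by norm_num) fun u => (hb u).1
  have hμ := dualityMeasure_nonneg_of_mem_nbhdN2 h
  refine ⟨?_, normalMatrix_mulVec_eq_add_adjustVec h.2.1 hQ _ _⟩
  rw [l2norm_sq]
  refine (adjustVec_dotProduct_self_le h hθ0 hW _ _).trans ?_
  -- `K = 1 + 1/2` and `L = 1 / (1 - 1/2)`, so `K * L = 3` and the rate is `2/3`; the final constant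
  -- is `6 = (K * L) * L`.
  have hres := pinv_mulVec_pcg_residual_le hQ (K := 3 / 2) (L := 2) (by norm_num) (by norm_num)
    (by norm_num) (fun u => by linarith [(hb u).2]) (fun u => by linarith [(hb u).1])
    (scaledResidual x s σ) t
  rw [← rhsP_eq_mulVec A h.1 h.2.1, ← normalMatrix_eq] at hres
  have hg := scaledResidual_dotProduct_self_le hθ1 h hσ0 hσ1
  have hn : (0 : ℝ) ≤ n := Nat.cast_nonneg n
  have hc : 0 ≤ (1 + θ) * dualityMeasure x s := mul_nonneg (by linarith) hμ
  have hr : (1 : ℝ) - 1 / (3 / 2 * 2) = 2 / 3 := by norm_num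
  rw [hr] at hres
  calc _ ≤ (1 + θ) * dualityMeasure x s * (n * (3 / 2 * 2 * (2 / 3) ^ t *
        (2 * (n * ((1 + θ) ^ 2 * dualityMeasure x s / (1 - θ)))))) := by
        refine mul_le_mul_of_nonneg_left (mul_le_mul_of_nonneg_left (hres.trans ?_) hn) hc
        gcongr
    _ = _ := by ring

end Solver

/-! ### ### Iteration count and the probabilistic statement -/

/-- In logarithms the claim is `log c + 2 log (a / δ) ≤ t log (3/2)`. As `log c ≥ 0`, the left side
is at most `(2 + log c) * max 1 (log (a / δ))`. -/
theorem mul_sq_mul_two_thirds_pow_le {c a δ : ℝ} (hc : 1 ≤ c) (ha : 0 < a) (hδ : 0 < δ) {t : ℕ}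
    (ht : (2 + Real.log c) / Real.log (3 / 2) * max 1 (Real.log (a / δ)) ≤ t) :
    c * a ^ 2 * (2 / 3) ^ t ≤ δ ^ 2 := by
  have hl : 0 < Real.log (3 / 2) := Real.log_pos (by norm_num)
  have hlc : 0 ≤ Real.log c := Real.log_nonneg hc
  have hc0 : 0 < c := by linarith
  rw [div_mul_eq_mul_div, div_le_iff₀ hl] at ht
  have h1 := le_max_left 1 (Real.log (a / δ))
  have h2 := le_max_right 1 (Real.log (a / δ))
  have h3 : Real.log c + 2 * Real.log (a / δ) ≤ t * Real.log (3 / 2) := by nlinarith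
  have h4 : c * (a / δ) ^ 2 ≤ (3 / 2) ^ t := by
    rw [← Real.log_le_log_iff (by positivity) (by positivity), Real.log_mul (by positivity)
      (by positivity), Real.log_pow, Real.log_pow]
    exact_mod_cast h3
  rw [div_pow, ← mul_div_assoc, div_le_iff₀ (by positivity)] at h4
  have h5 : ((3 : ℝ) / 2) ^ t * (2 / 3) ^ t = 1 := by rw [← mul_pow]; norm_num
  calc c * a ^ 2 * (2 / 3) ^ t ≤ (3 / 2) ^ t * δ ^ 2 * (2 / 3) ^ t :=
        mul_le_mul_of_nonneg_right h4 (by positivity)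
    _ = (3 / 2) ^ t * (2 / 3) ^ t * δ ^ 2 := by ring
    _ = δ ^ 2 := by rw [h5, one_mul]

theorem mainTheorem4 (θ : ℝ) (hθ0 : 0 ≤ θ) (hθ1 : θ < 1) :
    ∃ C : ℝ, 0 < C ∧
      ∀ (m n w k : ℕ) (A : Matrix (Fin m) (Fin n) ℝ), A.rank = m →
      ∀ (x : Fin n → ℝ) (y : Fin m → ℝ) (s : Fin n → ℝ), (x, y, s) ∈ nbhdN2 m n θ →
      ∀ (U : Matrix (Fin m) (Fin m) ℝ) (sv : Fin m → ℝ) (V : Matrix (Fin n) (Fin m) ℝ),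
        IsThinSVD (A * scalingD x s) U sv V →
      ∀ (σ ζ η δ : ℝ), 0 ≤ σ → σ ≤ 1 → 0 < ζ → ζ < 1 → 0 < η → η < 1 → 0 < δ →
      ∀ (Ω : Type*) [MeasurableSpace Ω] (P : Measure Ω) [IsProbabilityMeasure P]
        (W : Ω → Matrix (Fin n) (Fin w) ℝ),
        (∀ i j, Measurable fun ω => W ω i j) →
        (∀ᵐ ω ∂P, IsSparseSketch k (W ω)) →
        1 - η ≤ P.real {ω | specNorm (Vᵀ * W ω * (W ω)ᵀ * V - 1) ≤ ζ / 2} →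
        1 - η ≤ P.real {ω | ∀ t : ℕ,
          C * max 1 (Real.log (n * dualityMeasure x s / δ)) ≤ t →
          let p := rhsP A x s σ
          let dy := pcg (A * scalingD x s) p (W ω) t
          let v := adjustVec A x s p (W ω) dy
          l2norm v ≤ δ ∧
            normalMatrix A x s *ᵥ dy = p + (A * diagonal fun i => (s i)⁻¹) *ᵥ v} := by
  have hc : 1 ≤ 6 * (1 + θ) ^ 3 / (1 - θ) := by
    rw [le_div_iff₀ (by linarith)]
    nlinarith [one_le_pow₀ (M₀ := ℝ) (a := 1 + θ) (n := 3) (by linarith)]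
  refine ⟨(2 + Real.log (6 * (1 + θ) ^ 3 / (1 - θ))) / Real.log (3 / 2),
    div_pos (by linarith [Real.log_nonneg hc]) (Real.log_pos (by norm_num)), ?_⟩
  intro m n w k A hA x y s h U sv V hsvd σ ζ η δ hσ0 hσ1 _ hζ1 _ _ hδ Ω _ P _ W _ hW hP
  -- The embedding event lies in the target event up to a null set, sparsity being only almost sure.
  -- The bound for all `t` holds pointwise, so no union bound over `t` is needed.
  refine hP.trans (ENNReal.toReal_mono (measure_ne_top P _) (measure_mono_ae ?_))
  filter_upwards [hW] with ω hω hspec t ht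
  obtain ⟨h1, h2⟩ := adjustVec_pcg hA hθ0 hθ1 h hsvd hσ0 hσ1 hω
    (le_trans (b := ζ / 2) hspec (by linarith)) t
  refine ⟨?_, h2⟩
  refine le_of_sq_le_sq (h1.trans ?_) hδ.le
  -- For `n = 0` the quantity `n μ` vanishes and the logarithm is a default value, but the bound on
  -- `‖v‖²` is itself zero.
  rcases Nat.eq_zero_or_pos n with rfl | hn
  · simpa using sq_nonneg δ
  · exact mul_sq_mul_two_thirds_pow_le hc
      (mul_pos (Nat.cast_pos.mpr hn) (dualityMeasure_pos_of_mem_nbhdN2 h hn)) hδ ht
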